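/- Multiway Cut: given a finite graph $G=(V,E)$ with edge weights $w_e\ge 0$ and $k\ge 1$ distinct terminals $t_1,\dots,t_k\in V$, find a minimum-weight set $F\subseteq E$ such that no two terminals are connected in $(V,E\setminus F)$. Let $\Delta=\{x\in\mathbb{R}^k: x\ge 0,\ \sum_i x_i=1\}$. Its relaxation minimizes $\mathrm{LP}(x)=\sum_{uv\in E} w_{uv}\cdot\frac12\|x_u-x_v\|_1$ over maps $v\mapsto x_v\in\Delta$ such that $x_{t_i}$ is the $i$-th unit vector for every $i$. Let $$a=\frac{4+2\sqrt5}{3},\quad b=\sqrt5-2,\quad p=\frac{5+3\sqrt5}{20},\quad \alpha=\frac{3+\sqrt5}{4}\approx 1.309017,$$ and let $\phi(u)=au$ for $0\le u\le b$ and $\phi(u)=\frac a2(u+b)$ for $b\le u\le 1$ (equivalently, $\phi(u)=\min\{au,\frac a2(u+b)\}$ on $[0,1]$). Consider the following random labeling $\ell:\Delta\to\{1,\dots,k\}$. (i) With probability $p$ (Exponential Clocks): draw independent exponential random variables $Z_1,\dots,Z_k$ of rate one and let $\ell(x)=\arg\min_i Z_i/x_i$, where $Z_i/0=+\infty$. (ii)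 With probability $1-p$ (Single Threshold): draw $\theta\in(0,1]$ with density $\phi$ and, independently, a uniformly random permutation $\sigma$ of $\{1,\dots,k\}$, and let $\ell(x)=\sigma(i)$ for the least $i\le k-1$ with $x_{\sigma(i)}\ge\theta$ if there is one, and $\ell(x)=\sigma(k)$ otherwise. Then this is a well-defined probability distribution on labelings, and rounding the relaxation with it is an $\alpha$-approximation for Multiway Cut. That is: the relaxation has an optimal solution. For every feasible solution $x$, almost surely $\ell(x_{t_i})=i$ for all $i$ and the set of edges $uv$ with $\ell(x_u)\ne\ell(x_v)$ is a multiway cut, and the expected weight of this set is at most $\alpha\cdot\mathrm{LP}(x)$. If $x$ is an optimal solution, the expected weight is therefore at most $\alpha$ times the minimum weight of a multiway cut. -/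

import Mathlib

open MeasureTheory ProbabilityTheory

namespace MultiwayCut

/-! ### Multiway Cut instances and the simplex relaxation

An instance is a finite graph `G` on `V`, a weight `w e ≥ 0` for each edge, and `k` distinct
terminals `t 0, …, t (k - 1)`. -/

section Instance

variable {V : Type*} {k : ℕ}

/-- Total weight of a finite set of edges. -/
def weight (w : Sym2 V → ℝ) (F : Finset (Sym2 V)) : ℝ := ∑ e ∈ F, w e

/-- `F` is a multiway cut: a set of edges whose deletion leaves no two distinct terminals in the
same connected component. -/
def IsMultiwayCut (G : SimpleGraph V) (t : Fin k → V) (F : Finset (Sym2 V)) : Prop :=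
  (F : Set (Sym2 V)) ⊆ G.edgeSet ∧
    ∀ i j : Fin k, i ≠ j → ¬ (G.deleteEdges (F : Set (Sym2 V))).Reachable (t i) (t j)

open Classical in
/-- The edges of `G` whose endpoints receive different labels. -/
noncomputable def cutEdges [Fintype V] (G : SimpleGraph V) (lab : V → Fin k) :
    Finset (Sym2 V) :=
  G.edgeFinset.filter fun e => ¬ (e.map lab).IsDiag

/-- The length `½ ‖x_u - x_v‖₁` of the pair `{u, v}` under an embedding `x` in the simplex. -/
noncomputable def edgeLength (x : V → stdSimplex ℝ (Fin k)) : Sym2 V → ℝ :=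
  Sym2.lift ⟨fun u v => (1 / 2) * ∑ i, |x u i - x v i|, fun u v => by
    simp only [abs_sub_comm]⟩

open Classical in
/-- The objective value of the relaxation at `x`. -/
noncomputable def lpValue [Fintype V] (G : SimpleGraph V) (w : Sym2 V → ℝ)
    (x : V → stdSimplex ℝ (Fin k)) : ℝ :=
  ∑ e ∈ G.edgeFinset, w e * edgeLength x e

/-- `x` is a feasible solution of the relaxation: an embedding of the vertices in the simplex with
the `i`-th terminal mapped to the `i`-th vertex of the simplex. -/
def IsFeasible (t : Fin k → V) (x : V → stdSimplex ℝ (Fin k)) : Prop :=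
  ∀ i : Fin k, (x (t i) : Fin k → ℝ) = Pi.single i 1

/-- `x` is an optimal solution of the relaxation. -/
def IsOptimal [Fintype V] (G : SimpleGraph V) (w : Sym2 V → ℝ) (t : Fin k → V)
    (x : V → stdSimplex ℝ (Fin k)) : Prop :=
  IsFeasible t x ∧ ∀ y : V → stdSimplex ℝ (Fin k), IsFeasible t y → lpValue G w x ≤ lpValue G w y

end Instance

/-! ### Rounding schemes -/

section Rounding

variable {k : ℕ}

/-- Labelings of the simplex by terminals. They carry the product σ-algebra, and a randomized
rounding scheme is a probability measure on this space. -/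
abbrev Labeling (k : ℕ) : Type := stdSimplex ℝ (Fin k) → Fin k

/-- `i` minimizes `z i / x i`, where the quotient is read as `+∞` if `x i = 0`. -/
def IsClockMin (z : Fin k → ℝ) (x : stdSimplex ℝ (Fin k)) (i : Fin k) : Prop :=
  0 < x i ∧ ∀ j : Fin k, 0 < x j → z i / x i ≤ z j / x j

theorem exists_isClockMin (z : Fin k → ℝ) (x : stdSimplex ℝ (Fin k)) :
    ∃ i, IsClockMin z x i := by
  classical
  have hne : (Finset.univ.filter fun i : Fin k => 0 < x i).Nonempty := by
    by_contra h
    have h0 : ∀ i, x i = 0 := fun i => by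
      by_contra hi
      exact h ⟨i, by simpa using lt_of_le_of_ne (stdSimplex.zero_le x i) (Ne.symm hi)⟩
    have h1 := stdSimplex.sum_eq_one x
    simp [h0] at h1
  obtain ⟨i, hi, hmin⟩ := Finset.exists_min_image _ (fun i => z i / x i) hne
  exact ⟨i, by simpa using hi, fun j hj => hmin j (by simpa using hj)⟩

open Classical in
/-- Exponential clocks with clock values `z`: the point `x` goes to `argmin_i z i / x i`
(ties, which have probability zero, go to the least index). -/
noncomputable def clockLabeling (z : Fin k → ℝ) : Labeling k :=
  fun x => Fin.find (IsClockMin z x) (exists_isClockMin z x)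

/-- The law of the labeling produced by independent exponential clocks of rate one. -/
noncomputable def exponentialClocks (k : ℕ) : Measure (Labeling k) :=
  (Measure.pi fun _ : Fin k => expMeasure 1).map clockLabeling

/-- When the terminals are processed in the order `σ 0, σ 1, …, σ (k - 1)` with threshold `θ`,
the point `x` is assigned in step `i` if `x (σ i) ≥ θ`, and in any case in the last step. -/
def Captures (θ : ℝ) (σ : Equiv.Perm (Fin k)) (x : stdSimplex ℝ (Fin k)) (i : Fin k) : Prop :=
  θ ≤ x (σ i) ∨ (i : ℕ) + 1 = k

theorem exists_captures (θ : ℝ) (σ : Equiv.Perm (Fin k)) (x : stdSimplex ℝ (Fin k)) :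
    ∃ i, Captures θ σ x i := by
  have hk : 0 < k := by
    rcases Nat.eq_zero_or_pos k with rfl | h
    · have h1 := stdSimplex.sum_eq_one x
      simp at h1
    · exact h
  exact ⟨⟨k - 1, by omega⟩, Or.inr (by simp; omega)⟩

open Classical in
/-- Single threshold rounding with threshold `θ` and order `σ`: each point goes to the first
terminal in the order `σ` that captures it. -/
noncomputable def thresholdLabeling (θ : ℝ) (σ : Equiv.Perm (Fin k)) : Labeling k :=
  fun x => σ (Fin.find (Captures θ σ x) (exists_captures θ σ x))

/-- The law on `(0, 1]` with density `φ`. -/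
noncomputable def thresholdMeasure (φ : ℝ → ℝ) : Measure ℝ :=
  (volume.restrict (Set.Ioc 0 1)).withDensity fun u => ENNReal.ofReal (φ u)

/-- The law of the labeling produced by single threshold rounding, with `θ` of density `φ` and an
independent uniformly random order of the terminals. -/
noncomputable def singleThreshold (k : ℕ) (φ : ℝ → ℝ) : Measure (Labeling k) :=
  ∑ σ : Equiv.Perm (Fin k),
    (Fintype.card (Equiv.Perm (Fin k)) : ENNReal)⁻¹ •
      (thresholdMeasure φ).map fun θ => thresholdLabeling θ σ

/-- Exponential clocks with probability `p`, single threshold rounding with probability `1 - p`. -/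
noncomputable def mixedScheme (k : ℕ) (p : ℝ) (φ : ℝ → ℝ) : Measure (Labeling k) :=
  ENNReal.ofReal p • exponentialClocks k + ENNReal.ofReal (1 - p) • singleThreshold k φ

/-- The piecewise linear threshold density with parameters `a` and `b`. -/
noncomputable def thresholdDensity (a b u : ℝ) : ℝ :=
  if u ≤ b then a * u else a / 2 * (u + b)

end Rounding

end MultiwayCut

namespace MultiwayCut

/-! ### Exponential clocks -/

section Clocks

/-! By linearity of expectation it suffices that any two points of the simplex are separated with
probability at most `α` times half their ℓ₁ distance. Separation probabilities obey the triangle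
inequality, and any two points are joined by mass transfers whose sizes add up to that distance, so
only a transfer of `ε` from `j` to `i` matters; reversing or splitting it, one may assume `x j ≤ x
i` at its start.

For such a transfer the clocks separate with probability at most `ε (2 - x i - x j)`
(`exponentialClocks_ne_le`). The threshold separates only if it falls between the old and new value
of coordinate `i`, or, when `j` precedes `i`, of coordinate `j` (`singleThreshold_ne_le`). Bounding
the density by its branch `a/2 (u + b)` on the first interval and by `a u` on the second gives
`(a/2) ε (x i + x j + b)`, the `ε²` terms cancelling. Since `(1 - p) a = 2p`, the dependence on `x`
cancels in the mixture and `p (2 + b) ε = α ε` remains (`mixedScheme_ne_le_of_le`).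

The comparison with a minimum multiway cut holds because labeling vertices by components turns a cut
into a feasible point of no larger value. -/

instance isProbabilityMeasure_expMeasure_one : IsProbabilityMeasure (expMeasure 1) :=
  isProbabilityMeasure_expMeasure one_pos

theorem expMeasure_one_Ioi {t : ℝ} (ht : 0 ≤ t) :
    expMeasure 1 (Set.Ioi t) = ENNReal.ofReal (Real.exp (-t)) := by
  have h := cdf_expMeasure_eq (r := 1) one_pos t
  rw [if_pos ht, cdf_eq_real, one_mul] at h
  rw [← Set.compl_Iic, ← ofReal_measureReal (by simp), probReal_compl_eq_one_sub measurableSet_Iic,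
    h, sub_sub_cancel]

theorem expMeasure_one_Iic_zero : expMeasure 1 (Set.Iic 0) = 0 := by
  have h := cdf_expMeasure_eq (r := 1) one_pos 0
  rw [if_pos le_rfl, cdf_eq_real] at h
  simpa [measureReal_eq_zero_iff] using h

/-- Tilting the rate-one density by `exp (-(s * a))` gives `1 / (1 + s)` times the density of rate
`1 + s`. -/
theorem lintegral_expMeasure_one_exp {s : ℝ} (hs : 0 ≤ s) (f : ℝ → ENNReal) (hf : Measurable f)
    (h : ∀ a, 0 ≤ a → f a = ENNReal.ofReal (Real.exp (-(s * a)))) :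
    ∫⁻ a, f a ∂(expMeasure 1) = ENNReal.ofReal (1 / (1 + s)) := by
  have hd : expMeasure 1 = volume.withDensity (exponentialPDF 1) := rfl
  have hm : ∀ r, Measurable (exponentialPDF r) := fun r =>
    (measurable_exponentialPDFReal r).ennreal_ofReal
  rw [hd, lintegral_withDensity_eq_lintegral_mul _ (hm 1) hf]
  have : ∀ a, (exponentialPDF 1 * f) a = ENNReal.ofReal (1 / (1 + s)) * exponentialPDF (1 + s) a := by
    intro a
    rcases lt_or_ge a 0 with ha | ha
    · simp [exponentialPDF_of_neg ha]
    · rw [Pi.mul_apply, exponentialPDF_of_nonneg ha, exponentialPDF_of_nonneg ha, h a ha,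
        ← ENNReal.ofReal_mul (by positivity), ← ENNReal.ofReal_mul (by positivity)]
      congr 1
      have : (1 + s) ≠ 0 := by positivity
      rw [one_mul, ← Real.exp_add, ← mul_assoc, one_div, inv_mul_cancel₀ this]
      ring_nf
  simp_rw [this]
  rw [lintegral_const_mul _ (hm _), lintegral_exponentialPDF_eq_one (by positivity), mul_one]

/-- The event that the `i`-th of the ratios `z j / c j` is strictly smallest. -/
def strictMinEvent {k : ℕ} (c : Fin k → ℝ) (i : Fin k) : Set (Fin k → ℝ) :=
  {z | ∀ j, j ≠ i → z i * c j < c i * z j}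

/-- Given `z i = a`, the other clocks independently exceed `a * c j / c i`, with probability `exp
(-a ∑ c j / c i)` in total; then integrate over `a`. The sum of `c` is left arbitrary because the
lemma is applied to envelopes of two points, which may lie off the simplex. -/
theorem pi_expMeasure_strictMinEvent {k : ℕ} (c : Fin k → ℝ) (hc : ∀ i, 0 ≤ c i) (i : Fin k)
    (hi : 0 < c i) :
    (Measure.pi fun _ : Fin k => expMeasure 1) (strictMinEvent c i) =
      ENNReal.ofReal (c i / ∑ j, c j) := by
  obtain _ | n := k
  · exact i.elim0
  have hmp := (measurePreserving_piFinSuccAbove (fun _ : Fin (n + 1) => expMeasure 1) i).symm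
  have hS : MeasurableSet (strictMinEvent c i) := by
    have : strictMinEvent c i = ⋂ j, ⋂ (_ : j ≠ i), {z | z i * c j < c i * z j} := by
      ext; simp [strictMinEvent]
    rw [this]
    exact .iInter fun j => .iInter fun _ => measurableSet_lt (by fun_prop) (by fun_prop)
  rw [← hmp.measure_preimage hS.nullMeasurableSet, Measure.prod_apply (hmp.measurable hS)]
  have key : ∀ a, Prod.mk a ⁻¹'
      ((MeasurableEquiv.piFinSuccAbove (fun _ : Fin (n + 1) => ℝ) i).symm ⁻¹' strictMinEvent c i) =
      Set.univ.pi fun m => Set.Ioi (a * c (i.succAbove m) / c i) := by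
    intro a
    ext y
    simp only [strictMinEvent, Set.mem_preimage, Set.mem_ofPred_eq, Set.mem_pi, Set.mem_univ,
      true_imp_iff, Set.mem_Ioi, MeasurableEquiv.piFinSuccAbove_symm_apply, Fin.insertNthEquiv,
      Equiv.coe_fn_mk]
    constructor
    · intro h m
      have := h (i.succAbove m) (Fin.succAbove_ne i m)
      rw [div_lt_iff₀ hi]
      simpa [mul_comm (c i)] using this
    · intro h j hj
      obtain ⟨m, rfl⟩ := Fin.exists_succAbove_eq hj
      have := h m
      rw [div_lt_iff₀ hi] at this
      simpa [mul_comm (c i)] using this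
  have hs : 0 ≤ (∑ m, c (i.succAbove m)) / c i :=
    div_nonneg (Finset.sum_nonneg fun _ _ => hc _) hi.le
  rw [lintegral_expMeasure_one_exp hs _ (measurable_measure_prodMk_left (hmp.measurable hS))]
  · rw [Fin.sum_univ_succAbove c i]
    congr 1
    field_simp
  · intro a ha
    rw [key, Measure.pi_pi]
    rw [Finset.prod_congr rfl fun m _ => expMeasure_one_Ioi
      (div_nonneg (mul_nonneg ha (hc _)) hi.le), ← ENNReal.ofReal_prod_of_nonneg
      (fun _ _ => (Real.exp_pos _).le), ← Real.exp_sum]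
    congr 2
    rw [Finset.sum_neg_distrib, Finset.sum_div, Finset.sum_mul]
    congr 1
    exact Finset.sum_congr rfl fun _ _ => by ring

theorem pi_expMeasure_ae_pos (k : ℕ) :
    ∀ᵐ z ∂(Measure.pi fun _ : Fin k => expMeasure 1), ∀ i, 0 < z i := by
  rw [ae_all_iff]
  intro i
  have h : ∀ᵐ a ∂(expMeasure 1), 0 < a := by
    rw [ae_iff]
    simp only [not_lt]
    exact expMeasure_one_Iic_zero
  exact (measurePreserving_eval (fun _ : Fin k => expMeasure 1) i).quasiMeasurePreserving.ae h

variable {k : ℕ}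

open Classical in
theorem clockLabeling_eq_of_strictMin {z : Fin k → ℝ} {x : stdSimplex ℝ (Fin k)} {i : Fin k}
    (hi : 0 < x i) (h : ∀ j, j ≠ i → z i * x j < x i * z j) : clockLabeling z x = i := by
  by_contra hne
  obtain ⟨h0, h1⟩ := Fin.find_spec (exists_isClockMin z x)
  have h2 := h1 i hi
  rw [div_le_div_iff₀ h0 hi] at h2
  have h3 := h _ hne
  unfold clockLabeling at h3
  nlinarith

open Classical in
theorem measurable_clockLabeling : Measurable (clockLabeling (k := k)) := by
  refine measurable_pi_lambda _ fun x => measurable_to_countable' fun i => ?_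
  have hm : ∀ j, MeasurableSet {z : Fin k → ℝ | IsClockMin z x j} := by
    intro j
    have : {z : Fin k → ℝ | IsClockMin z x j} =
        {_z | 0 < x j} ∩ ⋂ l, ⋂ (_ : 0 < x l), {z | z j / x j ≤ z l / x l} := by
      ext; simp [IsClockMin]
    rw [this]
    refine (MeasurableSet.const _).inter ?_
    exact .iInter fun l => .iInter fun _ => measurableSet_le (by fun_prop) (by fun_prop)
  have : (fun z : Fin k → ℝ => clockLabeling z x) ⁻¹' {i} =
      {z | IsClockMin z x i} ∩ ⋂ j, ⋂ (_ : j < i), {z | IsClockMin z x j}ᶜ := by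
    ext z
    simp [clockLabeling, Fin.find_eq_iff]
  rw [this]
  exact (hm i).inter (.iInter fun j => .iInter fun _ => (hm j).compl)

instance isProbabilityMeasure_exponentialClocks : IsProbabilityMeasure (exponentialClocks k) :=
  Measure.isProbabilityMeasure_map measurable_clockLabeling.aemeasurable

theorem measurableSet_labeling_ne (x y : stdSimplex ℝ (Fin k)) :
    MeasurableSet {lab : Labeling k | lab x ≠ lab y} :=
  (measurableSet_eq_fun (measurable_pi_apply x) (measurable_pi_apply y)).compl

/-- If `z ≥ 0` and `i` is the strict minimizer for `c`, it is so for every point below `c` that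
agrees with `c` at `i`. -/
theorem strictMinEvent_mono {z c d : Fin k → ℝ} {i : Fin k} (hz : ∀ j, 0 < z j)
    (hle : ∀ j, j ≠ i → d j ≤ c j) (hi : c i ≤ d i) (h : z ∈ strictMinEvent c i) :
    z ∈ strictMinEvent d i := fun j hj =>
  calc z i * d j ≤ z i * c j := by gcongr; exacts [(hz i).le, hle j hj]
    _ < c i * z j := h j hj
    _ ≤ d i * z j := by gcongr; exact (hz j).le

/-- If `i` wins strictly for the envelope `c i`, then it wins for both `x` and `y`, whose `i`-th
coordinates are no smaller and whose other coordinates are no larger. The events for different `i`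
are disjoint. -/
theorem sum_le_exponentialClocks_eq (x y : stdSimplex ℝ (Fin k)) (c : Fin k → Fin k → ℝ)
    (hc : ∀ i j, 0 ≤ c i j) (hx : ∀ i j, j ≠ i → x j ≤ c i j) (hy : ∀ i j, j ≠ i → y j ≤ c i j)
    (hxi : ∀ i, c i i ≤ x i) (hyi : ∀ i, c i i ≤ y i) :
    ∑ i, c i i / ∑ j, c i j ≤ (exponentialClocks k).real {lab | lab x = lab y} := by
  set P := Measure.pi fun _ : Fin k => expMeasure 1 with hP
  have hmeas : MeasurableSet {lab : Labeling k | lab x = lab y} :=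
    measurableSet_eq_fun (measurable_pi_apply x) (measurable_pi_apply y)
  have hmi : ∀ i, MeasurableSet {z : Fin k → ℝ | clockLabeling z x = i ∧ clockLabeling z y = i} :=
    fun i => (((measurable_pi_apply x).comp measurable_clockLabeling) (MeasurableSet.singleton i)).inter
      (((measurable_pi_apply y).comp measurable_clockLabeling) (MeasurableSet.singleton i))
  have hunion : clockLabeling ⁻¹' {lab : Labeling k | lab x = lab y} =
      ⋃ i, {z | clockLabeling z x = i ∧ clockLabeling z y = i} := by
    ext z; simp [eq_comm]
  rw [exponentialClocks, map_measureReal_apply measurable_clockLabeling hmeas, hunion,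
    measureReal_iUnion_fintype _ hmi]
  · refine Finset.sum_le_sum fun i _ => ?_
    have hs : 0 ≤ ∑ j, c i j := Finset.sum_nonneg fun j _ => hc i j
    rcases (hc i i).eq_or_lt with h0 | h0
    · rw [← h0, zero_div]; positivity
    rw [measureReal_def, ← ENNReal.ofReal_le_iff_le_toReal (measure_ne_top _ _),
      ← pi_expMeasure_strictMinEvent (c i) (hc i) i h0]
    refine measure_mono_ae ?_
    filter_upwards [pi_expMeasure_ae_pos k] with z hz h
    exact ⟨clockLabeling_eq_of_strictMin (h0.trans_le (hxi i))
        (strictMinEvent_mono hz (hx i) (hxi i) h),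
      clockLabeling_eq_of_strictMin (h0.trans_le (hyi i))
        (strictMinEvent_mono hz (hy i) (hyi i) h)⟩
  · intro i j hij
    exact Set.disjoint_left.2 fun z h1 h2 => hij (h1.1.symm.trans h2.1)

/-- `y` is obtained from `x` by moving mass `ε` from coordinate `j` to coordinate `i`. -/
structure IsTransfer (i j : Fin k) (ε : ℝ) (x y : stdSimplex ℝ (Fin k)) : Prop where
  ne : i ≠ j
  nonneg : 0 ≤ ε
  tgt : y i = x i + ε
  src : y j = x j - ε
  rest : ∀ l, l ≠ i → l ≠ j → y l = x l

theorem exponentialClocks_ne_le {i j : Fin k} {ε : ℝ} {x y : stdSimplex ℝ (Fin k)}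
    (h : IsTransfer i j ε x y) :
    (exponentialClocks k).real {lab | lab x ≠ lab y} ≤ ε * (2 - x i - x j) := by
  obtain ⟨hij, hε, hi, hj, hr⟩ := h
  set d : Fin k → ℝ := fun l => x l + if l = i then ε else 0 with hd
  have hdx : ∀ l, x l ≤ d l := fun l => by simp only [hd]; split_ifs <;> linarith
  have hdy : ∀ l, y l ≤ d l := fun l => by
    simp only [hd]
    split_ifs with hl
    · rw [hl, hi]
    · by_cases hl' : l = j
      · rw [hl', hj]; linarith
      · rw [hr l hl hl']; linarith
  -- The tightest envelopes: minimum of `x` and `y` at `l`, maximum elsewhere. For `i` and `j` these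
  -- are `x` and `y` themselves, of sum 1; for every other `l` it is `d`, of sum `1 + ε`.
  set c : Fin k → Fin k → ℝ := fun l => if l = i then x else if l = j then y else d with hcdef
  have hci : c i = x := by simp [hcdef]
  have hcj : c j = y := by simp [hcdef, hij.symm]
  have hcl : ∀ l, l ≠ i → l ≠ j → c l = d := fun l h1 h2 => by simp [hcdef, h1, h2]
  have hyx : ∀ l, l ≠ i → y l ≤ x l := fun l hl => by
    by_cases hl' : l = j
    · rw [hl', hj]; linarith
    · exact (hr l hl hl').le
  have hxy : ∀ l, l ≠ j → x l ≤ y l := fun l hl => by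
    by_cases hl' : l = i
    · rw [hl', hi]; linarith
    · exact (hr l hl' hl).ge
  have hcases : ∀ {p : Fin k → Prop}, p i → p j → (∀ l, l ≠ i → l ≠ j → p l) → ∀ l, p l := by
    intro p h1 h2 h3 l
    by_cases ha : l = i
    · exact ha ▸ h1
    by_cases hb : l = j
    · exact hb ▸ h2
    exact h3 l ha hb
  have hsd : ∑ l, d l = 1 + ε := by
    simp [hd, Finset.sum_add_distrib]
  have hle := sum_le_exponentialClocks_eq x y c
    (hcases (fun l => by rw [hci]; exact stdSimplex.zero_le x l)
      (fun l => by rw [hcj]; exact stdSimplex.zero_le y l)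
      (fun m h1 h2 l => by rw [hcl m h1 h2]; exact (stdSimplex.zero_le x l).trans (hdx l)))
    (hcases (fun l _ => by rw [hci]) (fun l hl => by rw [hcj]; exact hxy l hl)
      (fun m h1 h2 l _ => by rw [hcl m h1 h2]; exact hdx l))
    (hcases (fun l hl => by rw [hci]; exact hyx l hl) (fun l _ => by rw [hcj])
      (fun m h1 h2 l _ => by rw [hcl m h1 h2]; exact hdy l))
    (hcases (by rw [hci]) (by rw [hcj]; exact hyx j hij.symm)
      (fun m h1 h2 => by rw [hcl m h1 h2]; simp [hd, h1]))
    (hcases (by rw [hci]; exact hxy i hij) (by rw [hcj])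
      (fun m h1 h2 => by rw [hcl m h1 h2, hr m h1 h2]; simp [hd, h1]))
  have hsplit : ∀ f : Fin k → ℝ, ∑ l, f l = f i + f j + ∑ l ∈ (Finset.univ.erase i).erase j, f l := by
    intro f
    rw [← Finset.add_sum_erase _ f (Finset.mem_univ i),
      ← Finset.add_sum_erase _ f (Finset.mem_erase.2 ⟨hij.symm, Finset.mem_univ j⟩), add_assoc]
  have hsum : ∑ l, c l l / ∑ m, c l m = x i + (x j - ε) + (1 - x i - x j) / (1 + ε) := by
    rw [hsplit, hci, hcj, stdSimplex.sum_eq_one, stdSimplex.sum_eq_one, hj, div_one, div_one]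
    congr 1
    have h1 := hsplit x
    rw [stdSimplex.sum_eq_one] at h1
    rw [show 1 - x i - x j = ∑ l ∈ (Finset.univ.erase i).erase j, x l by linarith, Finset.sum_div]
    refine Finset.sum_congr rfl fun l hl => ?_
    simp only [Finset.mem_erase, Finset.mem_univ, and_true] at hl
    rw [hcl l hl.2 hl.1, hsd]
    simp [hd, hl.2]
  have hcompl : (exponentialClocks k).real {lab | lab x ≠ lab y} =
      1 - (exponentialClocks k).real {lab | lab x = lab y} :=
    probReal_compl_eq_one_sub (measurableSet_eq_fun (measurable_pi_apply x) (measurable_pi_apply y))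
  rw [hcompl]
  rw [hsum] at hle
  have hr0 : 0 ≤ 1 - x i - x j := by
    have h1 := hsplit x
    rw [stdSimplex.sum_eq_one] at h1
    have : 0 ≤ ∑ l ∈ (Finset.univ.erase i).erase j, x l :=
      Finset.sum_nonneg fun l _ => stdSimplex.zero_le x l
    linarith
  -- This is `1 - ε ≤ 1 / (1 + ε)`, which makes the bound linear in `ε`.
  have h2 : (1 - x i - x j) * (1 - ε) ≤ (1 - x i - x j) / (1 + ε) := by
    rw [le_div_iff₀ (by positivity)]
    nlinarith [mul_nonneg hr0 (sq_nonneg ε)]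
  nlinarith

end Clocks

/-! ### Single threshold rounding -/

section Threshold

theorem thresholdDensity_eq_min {a : ℝ} (ha : 0 ≤ a) (b u : ℝ) :
    thresholdDensity a b u = min (a * u) (a / 2 * (u + b)) := by
  unfold thresholdDensity
  split_ifs with h
  · rw [min_eq_left]; nlinarith
  · rw [min_eq_right]; nlinarith

theorem continuous_thresholdDensity {a : ℝ} (ha : 0 ≤ a) (b : ℝ) :
    Continuous (thresholdDensity a b) := by
  rw [funext (thresholdDensity_eq_min ha b)]
  fun_prop

/-- The density integrates to `a / 4 * (1 + 2 * b - b ^ 2)` over the unit interval. -/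
theorem isProbabilityMeasure_thresholdMeasure {a b : ℝ} (ha : 0 ≤ a) (hb : 0 ≤ b) (hb1 : b ≤ 1)
    (h : a * (1 + 2 * b - b ^ 2) = 4) :
    IsProbabilityMeasure (thresholdMeasure (thresholdDensity a b)) := by
  have hcont := continuous_thresholdDensity ha b
  refine ⟨?_⟩
  rw [thresholdMeasure, withDensity_apply _ MeasurableSet.univ, Measure.restrict_univ,
    ← ofReal_integral_eq_lintegral_ofReal]
  · rw [← intervalIntegral.integral_of_le zero_le_one,
      ← intervalIntegral.integral_add_adjacent_intervals (b := b)
        (hcont.intervalIntegrable _ _) (hcont.intervalIntegrable _ _)]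
    have h1 : ∫ u in (0 : ℝ)..b, thresholdDensity a b u = ∫ u in (0 : ℝ)..b, a * u := by
      refine intervalIntegral.integral_congr fun u hu => ?_
      rw [Set.uIcc_of_le hb] at hu
      simp [thresholdDensity, hu.2]
    have h2 : ∫ u in b..1, thresholdDensity a b u = ∫ u in b..1, a / 2 * (u + b) := by
      refine intervalIntegral.integral_congr fun u hu => ?_
      rw [Set.uIcc_of_le hb1] at hu
      simp only [thresholdDensity]
      split_ifs with hub
      · rw [le_antisymm hub hu.1]; ring
      · rfl
    rw [h1, h2, intervalIntegral.integral_const_mul, intervalIntegral.integral_const_mul,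
      intervalIntegral.integral_add (by simp) (by simp)]
    simp only [integral_id, intervalIntegral.integral_const, smul_eq_mul]
    rw [← ENNReal.ofReal_one]
    congr 1
    linarith
  · exact (hcont.integrableOn_Icc (a := 0) (b := 1)).mono_set Set.Ioc_subset_Icc_self
  · refine (ae_restrict_iff' measurableSet_Ioc).2 (.of_forall fun u hu => ?_)
    rw [thresholdDensity_eq_min ha]
    exact le_min (mul_nonneg ha hu.1.le) (mul_nonneg (by positivity) (add_nonneg hu.1.le hb))

theorem thresholdMeasure_Ioc_le {φ g : ℝ → ℝ} (hg : Continuous g) {c d : ℝ} (hcd : c ≤ d)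
    (hφ : ∀ u ∈ Set.Ioc c d, φ u ≤ g u) (hg0 : ∀ u ∈ Set.Ioc c d, 0 ≤ g u) :
    (thresholdMeasure φ).real (Set.Ioc c d) ≤ ∫ u in c..d, g u := by
  have hae : ∀ᵐ u ∂volume.restrict (Set.Ioc c d), 0 ≤ g u :=
    (ae_restrict_iff' measurableSet_Ioc).2 (.of_forall hg0)
  rw [intervalIntegral.integral_of_le hcd]
  refine ENNReal.toReal_le_of_le_ofReal (integral_nonneg_of_ae hae) ?_
  rw [ofReal_integral_eq_lintegral_ofReal
    ((hg.integrableOn_Icc (a := c) (b := d)).mono_set Set.Ioc_subset_Icc_self) hae,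
    thresholdMeasure, withDensity_apply _ measurableSet_Ioc]
  calc ∫⁻ u in Set.Ioc c d, ENNReal.ofReal (φ u) ∂volume.restrict (Set.Ioc 0 1)
      ≤ ∫⁻ u in Set.Ioc c d, ENNReal.ofReal (φ u) :=
        lintegral_mono' (Measure.restrict_mono le_rfl Measure.restrict_le_self) le_rfl
    _ ≤ ∫⁻ u in Set.Ioc c d, ENNReal.ofReal (g u) :=
        setLIntegral_mono' measurableSet_Ioc fun u hu => ENNReal.ofReal_le_ofReal (hφ u hu)

theorem thresholdMeasure_ae_mem (φ : ℝ → ℝ) : ∀ᵐ θ ∂thresholdMeasure φ, θ ∈ Set.Ioc (0 : ℝ) 1 :=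
  (withDensity_absolutelyContinuous _ _).ae_le (ae_restrict_mem measurableSet_Ioc)

variable {k : ℕ}

open Classical in
theorem measurable_thresholdLabeling (σ : Equiv.Perm (Fin k)) :
    Measurable fun θ => thresholdLabeling θ σ := by
  refine measurable_pi_lambda _ fun x => measurable_to_countable' fun i => ?_
  have hm : ∀ j, MeasurableSet {θ : ℝ | Captures θ σ x j} := by
    intro j
    have : {θ : ℝ | Captures θ σ x j} = Set.Iic (x (σ j)) ∪ {_θ | (j : ℕ) + 1 = k} := by
      ext; simp [Captures]
    rw [this]
    exact measurableSet_Iic.union (MeasurableSet.const _)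
  have : (fun θ => thresholdLabeling θ σ x) ⁻¹' {i} =
      {θ | Captures θ σ x (σ.symm i)} ∩ ⋂ j, ⋂ (_ : j < σ.symm i), {θ | Captures θ σ x j}ᶜ := by
    ext z
    simp [thresholdLabeling, ← Equiv.eq_symm_apply, Fin.find_eq_iff]
  rw [this]
  exact (hm _).inter (.iInter fun j => .iInter fun _ => (hm j).compl)

theorem singleThreshold_apply (φ : ℝ → ℝ) {s : Set (Labeling k)} (hs : MeasurableSet s) :
    singleThreshold k φ s = ∑ σ : Equiv.Perm (Fin k),
      (Fintype.card (Equiv.Perm (Fin k)) : ENNReal)⁻¹ *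
        thresholdMeasure φ {θ | thresholdLabeling θ σ ∈ s} := by
  simp only [singleThreshold, Measure.finsetSum_apply, Measure.smul_apply, smul_eq_mul]
  exact Finset.sum_congr rfl fun σ _ => by
    rw [Measure.map_apply (measurable_thresholdLabeling σ) hs]; rfl

theorem isProbabilityMeasure_singleThreshold (φ : ℝ → ℝ)
    [IsProbabilityMeasure (thresholdMeasure φ)] : IsProbabilityMeasure (singleThreshold k φ) := by
  refine ⟨?_⟩
  rw [singleThreshold_apply φ MeasurableSet.univ]
  simp only [Set.mem_univ, Set.ofPred_true, measure_univ, mul_one, Finset.sum_const,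
    Finset.card_univ, nsmul_eq_mul]
  exact ENNReal.mul_inv_cancel (by simp [Fintype.card_ne_zero]) (by simp)

theorem singleThreshold_real_apply (φ : ℝ → ℝ) [IsProbabilityMeasure (thresholdMeasure φ)]
    {s : Set (Labeling k)} (hs : MeasurableSet s) :
    (singleThreshold k φ).real s = (Fintype.card (Equiv.Perm (Fin k)) : ℝ)⁻¹ *
      ∑ σ : Equiv.Perm (Fin k), (thresholdMeasure φ).real {θ | thresholdLabeling θ σ ∈ s} := by
  rw [measureReal_def, singleThreshold_apply φ hs, ENNReal.toReal_sum, Finset.mul_sum]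
  · simp [measureReal_def]
  · intro σ _
    exact ENNReal.mul_ne_top (by simp [Fintype.card_ne_zero]) (measure_ne_top _ _)

open Classical in
-- Steps after one that captures `x` cannot affect the label, so agreement up to that step suffices.
theorem thresholdLabeling_congr {θ : ℝ} {σ : Equiv.Perm (Fin k)} {x y : stdSimplex ℝ (Fin k)}
    {n : Fin k} (hn : Captures θ σ x n)
    (h : ∀ m ≤ n, Captures θ σ x m ↔ Captures θ σ y m) :
    thresholdLabeling θ σ x = thresholdLabeling θ σ y := by
  refine congrArg σ (Eq.symm ((Fin.find_eq_iff _).2 ?_))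
  have hle := Fin.find_le_of_pos (exists_captures θ σ x) hn
  exact ⟨(h _ hle).1 (Fin.find_spec _), fun j hj hc =>
    Fin.find_min _ hj ((h j (hj.le.trans hle)).2 hc)⟩

theorem setOf_thresholdLabeling_ne_subset {i j : Fin k} {ε : ℝ} {x y : stdSimplex ℝ (Fin k)}
    (h : IsTransfer i j ε x y) (hx : x j ≤ x i) (σ : Equiv.Perm (Fin k)) :
    {θ | thresholdLabeling θ σ x ≠ thresholdLabeling θ σ y} ⊆
      Set.Ioc (x i) (y i) ∪ if σ.symm j < σ.symm i then Set.Ioc (y j) (x j) else ∅ := by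
  intro θ hθ
  by_contra hmem
  obtain ⟨h1, h2⟩ := not_or.1 hmem
  refine hθ ?_
  have hi : θ ≤ x i ↔ θ ≤ y i := by
    refine ⟨fun h' => ?_, fun h' => ?_⟩
    · rw [h.tgt]; linarith [h.nonneg]
    · by_contra hlt
      exact h1 ⟨not_le.1 hlt, h'⟩
  have hagree : ∀ m, σ m ≠ j → (Captures θ σ x m ↔ Captures θ σ y m) := by
    intro m hm
    by_cases hmi : σ m = i
    · simp only [Captures, hmi, hi]
    · simp only [Captures, h.rest _ hmi hm]
  by_cases hj : θ ∈ Set.Ioc (y j) (x j)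
  · have hlt : σ.symm i < σ.symm j := by
      refine lt_of_le_of_ne (not_lt.1 fun hlt => h2 (by rwa [if_pos hlt])) fun he =>
        h.ne (σ.symm.injective he)
    refine thresholdLabeling_congr (n := σ.symm i) (Or.inl ?_) fun m hm => hagree m ?_
    · rw [Equiv.apply_symm_apply]; exact hj.2.trans hx
    · rintro rfl
      rw [Equiv.symm_apply_apply] at hlt
      exact absurd hm (not_le.2 hlt)
  · obtain ⟨n, hn⟩ := exists_captures θ σ x
    refine thresholdLabeling_congr hn fun m _ => ?_
    by_cases hm : σ m = j
    · have : θ ≤ x j ↔ θ ≤ y j := by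
        refine ⟨fun h' => ?_, fun h' => ?_⟩
        · by_contra hlt
          exact hj ⟨not_le.1 hlt, h'⟩
        · have := h.src; linarith [h.nonneg]
      simp only [Captures, hm, this]
    · exact hagree m hm

/-- Composing with the transposition of `i` and `j` is a bijection of the permutations that
exchanges the two relative orders. -/
theorem two_mul_sum_perm_symm_lt {i j : Fin k} (hij : i ≠ j) :
    2 * ∑ σ : Equiv.Perm (Fin k), (if σ.symm j < σ.symm i then (1 : ℝ) else 0) =
      Fintype.card (Equiv.Perm (Fin k)) := by
  have hswap := Equiv.sum_comp (Equiv.mulLeft (Equiv.swap i j))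
    fun σ : Equiv.Perm (Fin k) => if σ.symm j < σ.symm i then (1 : ℝ) else 0
  rw [two_mul]
  nth_rewrite 1 [← hswap]
  rw [← Finset.sum_add_distrib]
  have : ∀ σ : Equiv.Perm (Fin k), ((if ((Equiv.mulLeft (Equiv.swap i j)) σ).symm j <
      ((Equiv.mulLeft (Equiv.swap i j)) σ).symm i then (1 : ℝ) else 0) +
      if σ.symm j < σ.symm i then (1 : ℝ) else 0) = 1 := by
    intro σ
    have e1 : ((Equiv.mulLeft (Equiv.swap i j)) σ).symm j = σ.symm i := by
      rw [Equiv.symm_apply_eq]; simp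
    have e2 : ((Equiv.mulLeft (Equiv.swap i j)) σ).symm i = σ.symm j := by
      rw [Equiv.symm_apply_eq]; simp
    rw [e1, e2]
    rcases lt_or_gt_of_ne (σ.symm.injective.ne hij) with h | h
    · simp [h, h.not_gt]
    · simp [h, h.not_gt]
  rw [Finset.sum_congr rfl fun σ _ => this σ]
  simp

theorem singleThreshold_ne_le (φ : ℝ → ℝ) [IsProbabilityMeasure (thresholdMeasure φ)]
    {i j : Fin k} {ε : ℝ} {x y : stdSimplex ℝ (Fin k)} (h : IsTransfer i j ε x y)
    (hx : x j ≤ x i) :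
    (singleThreshold k φ).real {lab | lab x ≠ lab y} ≤
      (thresholdMeasure φ).real (Set.Ioc (x i) (y i)) +
        1 / 2 * (thresholdMeasure φ).real (Set.Ioc (y j) (x j)) := by
  set A := (thresholdMeasure φ).real (Set.Ioc (x i) (y i))
  set B := (thresholdMeasure φ).real (Set.Ioc (y j) (x j))
  rw [singleThreshold_real_apply φ (measurableSet_labeling_ne x y)]
  have hb : ∀ σ : Equiv.Perm (Fin k),
      (thresholdMeasure φ).real {θ | thresholdLabeling θ σ ∈ {lab : Labeling k | lab x ≠ lab y}} ≤
        A + (if σ.symm j < σ.symm i then (1 : ℝ) else 0) * B := by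
    intro σ
    refine (measureReal_mono (setOf_thresholdLabeling_ne_subset h hx σ)).trans
      ((measureReal_union_le _ _).trans (add_le_add le_rfl ?_))
    split_ifs
    · rw [one_mul]
    · simp
  have hN : (0 : ℝ) < Fintype.card (Equiv.Perm (Fin k)) := by exact_mod_cast Fintype.card_pos
  rw [inv_mul_le_iff₀ hN]
  refine (Finset.sum_le_sum fun σ _ => hb σ).trans_eq ?_
  rw [Finset.sum_add_distrib, ← Finset.sum_mul, Finset.sum_const, Finset.card_univ, nsmul_eq_mul]
  have := two_mul_sum_perm_symm_lt h.ne
  linear_combination B / 2 * this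

end Threshold

/-! ### The mixed scheme -/

section Mixed

variable {k : ℕ}

theorem IsTransfer.symm {i j : Fin k} {ε : ℝ} {x y : stdSimplex ℝ (Fin k)}
    (h : IsTransfer i j ε x y) : IsTransfer j i ε y x where
  ne := h.ne.symm
  nonneg := h.nonneg
  tgt := by rw [h.src]; ring
  src := by rw [h.tgt]; ring
  rest l h1 h2 := (h.rest l h2 h1).symm

theorem exists_isTransfer {i j : Fin k} (hij : i ≠ j) {ε : ℝ} (hε : 0 ≤ ε)
    (x : stdSimplex ℝ (Fin k)) (hx : ε ≤ x j) : ∃ y, IsTransfer i j ε x y := by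
  refine ⟨⟨fun l => x l + ((if l = i then ε else 0) - if l = j then ε else 0), ?_, ?_⟩, ?_⟩
  · intro l
    have h0 := stdSimplex.zero_le x l
    by_cases h1 : l = i
    · have h2 : l ≠ j := fun h2 => hij (h1.symm.trans h2)
      simp only [if_pos h1, if_neg h2]; linarith
    · by_cases h2 : l = j
      · simp only [if_neg h1, if_pos h2]; subst h2; linarith
      · simp only [if_neg h1, if_neg h2]; linarith
  · simp [Finset.sum_add_distrib]
  · refine ⟨hij, hε, ?_, ?_, fun l h1 h2 => ?_⟩
    · change x i + _ = _
      simp [hij]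
    · change x j + _ = _
      simp [hij.symm, sub_eq_add_neg]
    · change x l + _ = _
      simp [h1, h2]

theorem isProbabilityMeasure_mixedScheme {p : ℝ} (hp : 0 ≤ p) (hp1 : p ≤ 1) (φ : ℝ → ℝ)
    [IsProbabilityMeasure (thresholdMeasure φ)] : IsProbabilityMeasure (mixedScheme k p φ) := by
  have := isProbabilityMeasure_singleThreshold (k := k) φ
  refine ⟨?_⟩
  simp only [mixedScheme, Measure.add_apply, Measure.smul_apply, smul_eq_mul, measure_univ, mul_one]
  rw [← ENNReal.ofReal_add hp (sub_nonneg.2 hp1), add_sub_cancel, ENNReal.ofReal_one]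

theorem mixedScheme_real_apply {p : ℝ} (hp : 0 ≤ p) (hp1 : p ≤ 1) (φ : ℝ → ℝ)
    [IsProbabilityMeasure (thresholdMeasure φ)] (s : Set (Labeling k)) :
    (mixedScheme k p φ).real s =
      p * (exponentialClocks k).real s + (1 - p) * (singleThreshold k φ).real s := by
  have := isProbabilityMeasure_singleThreshold (k := k) φ
  simp only [mixedScheme, measureReal_def, Measure.add_apply, Measure.smul_apply, smul_eq_mul]
  rw [ENNReal.toReal_add (ENNReal.mul_ne_top ENNReal.ofReal_ne_top (measure_ne_top _ _))
    (ENNReal.mul_ne_top ENNReal.ofReal_ne_top (measure_ne_top _ _)), ENNReal.toReal_mul,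
    ENNReal.toReal_mul, ENNReal.toReal_ofReal hp, ENNReal.toReal_ofReal (sub_nonneg.2 hp1)]

theorem mixedScheme_ne_le_of_le {a b p : ℝ} (ha : 0 ≤ a) (hb : 0 ≤ b) (hp : 0 ≤ p) (hp1 : p ≤ 1)
    (hap : (1 - p) * a = 2 * p) [IsProbabilityMeasure (thresholdMeasure (thresholdDensity a b))]
    {i j : Fin k} {ε : ℝ} {x y : stdSimplex ℝ (Fin k)} (h : IsTransfer i j ε x y)
    (hx : x j ≤ x i) :
    (mixedScheme k p (thresholdDensity a b)).real {lab | lab x ≠ lab y} ≤ p * (2 + b) * ε := by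
  have hε := h.nonneg
  have hE := exponentialClocks_ne_le h
  have hS := singleThreshold_ne_le (thresholdDensity a b) h hx
  have hA := thresholdMeasure_Ioc_le (φ := thresholdDensity a b) (g := fun u => a / 2 * (u + b))
    (by fun_prop) (c := x i) (d := y i) (by rw [h.tgt]; linarith)
    (fun u _ => by rw [thresholdDensity_eq_min ha]; exact min_le_right _ _)
    (fun u hu => mul_nonneg (by positivity)
      (add_nonneg ((stdSimplex.zero_le x i).trans hu.1.le) hb))
  have hB := thresholdMeasure_Ioc_le (φ := thresholdDensity a b) (g := fun u => a * u)
    (by fun_prop) (c := y j) (d := x j) (by rw [h.src]; linarith)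
    (fun u _ => by rw [thresholdDensity_eq_min ha]; exact min_le_left _ _)
    (fun u hu => mul_nonneg ha ((stdSimplex.zero_le y j).trans hu.1.le))
  rw [intervalIntegral.integral_const_mul, intervalIntegral.integral_add (by simp) (by simp),
    integral_id, intervalIntegral.integral_const, smul_eq_mul, h.tgt] at hA
  rw [intervalIntegral.integral_const_mul, integral_id, h.src] at hB
  rw [h.tgt, h.src] at hS
  rw [mixedScheme_real_apply hp hp1]
  have h1p : 0 ≤ 1 - p := sub_nonneg.2 hp1
  calc _ ≤ p * (ε * (2 - x i - x j)) + (1 - p) *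
        (a / 2 * (((x i + ε) ^ 2 - x i ^ 2) / 2 + (x i + ε - x i) * b) +
          1 / 2 * (a * ((x j ^ 2 - (x j - ε) ^ 2) / 2))) := by
        gcongr
        exact hS.trans (by gcongr)
    _ = p * (2 + b) * ε := by
        linear_combination (((x i + ε) ^ 2 - x i ^ 2) / 4 + ε * b / 2 +
          (x j ^ 2 - (x j - ε) ^ 2) / 4) * hap

theorem measureReal_ne_triangle (μ : Measure (Labeling k)) [IsFiniteMeasure μ]
    (x y z : stdSimplex ℝ (Fin k)) :
    μ.real {lab | lab x ≠ lab z} ≤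
      μ.real {lab | lab x ≠ lab y} + μ.real {lab | lab y ≠ lab z} :=
  (measureReal_mono fun lab h => by
    by_contra hn
    obtain ⟨h1, h2⟩ := not_or.1 hn
    exact h ((not_not.1 h1).trans (not_not.1 h2))).trans (measureReal_union_le _ _)

theorem measureReal_ne_comm (μ : Measure (Labeling k)) (x y : stdSimplex ℝ (Fin k)) :
    μ.real {lab | lab x ≠ lab y} = μ.real {lab | lab y ≠ lab x} := by
  simp only [ne_comm]

/-- A bound for transfers towards the larger coordinate extends to all transfers. -/
theorem measureReal_ne_le_of_isTransfer (μ : Measure (Labeling k)) [IsFiniteMeasure μ] {α : ℝ}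
    (hα : ∀ {i j : Fin k} {ε : ℝ} {x y : stdSimplex ℝ (Fin k)}, IsTransfer i j ε x y →
      x j ≤ x i → μ.real {lab | lab x ≠ lab y} ≤ α * ε)
    {i j : Fin k} {ε : ℝ} {x y : stdSimplex ℝ (Fin k)} (h : IsTransfer i j ε x y) :
    μ.real {lab | lab x ≠ lab y} ≤ α * ε := by
  rcases le_or_gt (x j) (x i) with h1 | h1
  · exact hα h h1
  rcases le_or_gt (y i) (y j) with h2 | h2
  · rw [measureReal_ne_comm]
    exact hα h.symm h2
  -- The order of the two coordinates flips during the transfer. It is split at the point `z` where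
  -- they are equal; from `z`, both halves satisfy the hypothesis of `hα`.
  rw [h.tgt, h.src] at h2
  obtain ⟨z, hz⟩ := exists_isTransfer h.ne (ε := (x j - x i) / 2) (by linarith) x
    (by linarith [stdSimplex.zero_le x i])
  have hzy : IsTransfer i j (ε - (x j - x i) / 2) z y :=
    ⟨h.ne, by linarith, by rw [hz.tgt, h.tgt]; ring, by rw [hz.src, h.src]; ring,
      fun l h1 h2 => by rw [hz.rest l h1 h2, h.rest l h1 h2]⟩
  have e1 := hα hz.symm (by rw [hz.tgt, hz.src]; linarith)
  have e2 := hα hzy (by rw [hz.tgt, hz.src]; linarith)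
  rw [measureReal_ne_comm] at e1
  linarith [measureReal_ne_triangle μ x z y]

/-- Any two points of the simplex are joined by transfers whose sizes add up to their distance. -/
theorem measureReal_ne_le_dist (μ : Measure (Labeling k)) [IsFiniteMeasure μ] {α : ℝ}
    (hα : ∀ {i j : Fin k} {ε : ℝ} {x y : stdSimplex ℝ (Fin k)}, IsTransfer i j ε x y →
      μ.real {lab | lab x ≠ lab y} ≤ α * ε)
    (x y : stdSimplex ℝ (Fin k)) :
    μ.real {lab | lab x ≠ lab y} ≤ α * ((1 / 2) * ∑ i, |x i - y i|) := by
  induction hn : (Finset.univ.filter fun l => x l ≠ y l).card using Nat.strong_induction_on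
    generalizing x with
  | _ n ih =>
  by_cases hxy : ∀ l, x l = y l
  · have : x = y := stdSimplex.ext (funext hxy)
    simp [this]
  have hsum : ∑ l, (x l - y l) = 0 := by
    rw [Finset.sum_sub_distrib, stdSimplex.sum_eq_one, stdSimplex.sum_eq_one, sub_self]
  push Not at hxy
  obtain ⟨m, hm⟩ := hxy
  obtain ⟨j, -, hj⟩ := Finset.exists_pos_of_sum_zero_of_exists_nonzero _ hsum
    ⟨m, Finset.mem_univ m, sub_ne_zero.2 hm⟩
  obtain ⟨i, -, hi⟩ := Finset.exists_pos_of_sum_zero_of_exists_nonzero (s := Finset.univ)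
    (fun l => y l - x l) (by rw [← neg_eq_zero, ← Finset.sum_neg_distrib]; simp)
    ⟨m, Finset.mem_univ m, sub_ne_zero.2 hm.symm⟩
  have hij : i ≠ j := by rintro rfl; linarith
  -- The largest transfer that overshoots neither target: it makes coordinate `i` or `j` agree with
  -- `y`, so the number of disagreements drops, and it uses up exactly `2 * ε` of the ℓ₁ distance.
  set ε := min (y i - x i) (x j - y j) with hε
  have hε1 : ε ≤ y i - x i := min_le_left _ _
  have hε2 : ε ≤ x j - y j := min_le_right _ _
  have hε0 : 0 < ε := lt_min hi hj
  obtain ⟨z, hz⟩ := exists_isTransfer hij hε0.le x (by linarith [stdSimplex.zero_le y j])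
  have hlt : (Finset.univ.filter fun l => z l ≠ y l).card < n := by
    rw [← hn]
    refine Finset.card_lt_card ⟨fun l => ?_, fun hsub => ?_⟩
    · simp only [Finset.mem_filter, Finset.mem_univ, true_and]
      intro hl
      by_cases h1 : l = i
      · subst h1; linarith
      by_cases h2 : l = j
      · subst h2; linarith
      rwa [← hz.rest l h1 h2]
    · have h1 : i ∈ Finset.univ.filter fun l => z l ≠ y l :=
        hsub (by simp only [Finset.mem_filter, Finset.mem_univ, true_and]; linarith)
      have h2 : j ∈ Finset.univ.filter fun l => z l ≠ y l :=
        hsub (by simp only [Finset.mem_filter, Finset.mem_univ, true_and]; linarith)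
      simp only [Finset.mem_filter, Finset.mem_univ, true_and] at h1 h2
      rw [hz.tgt] at h1
      rw [hz.src] at h2
      rcases min_choice (y i - x i) (x j - y j) with hc | hc
      · exact h1 (by rw [hε, hc]; ring)
      · exact h2 (by rw [hε, hc]; ring)
  have hdist : ∑ l, |x l - y l| = ∑ l, |z l - y l| + 2 * ε := by
    have : ∀ l, |x l - y l| = |z l - y l| + ((if l = i then ε else 0) + if l = j then ε else 0) := by
      intro l
      by_cases h1 : l = i
      · subst h1
        rw [if_pos rfl, if_neg hij, hz.tgt, abs_of_nonpos (by linarith),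
          abs_of_nonpos (by linarith)]
        ring
      by_cases h2 : l = j
      · subst h2
        rw [if_neg h1, if_pos rfl, hz.src, abs_of_nonneg (by linarith),
          abs_of_nonneg (by linarith)]
        ring
      rw [if_neg h1, if_neg h2, hz.rest l h1 h2]
      ring
    simp only [this, Finset.sum_add_distrib, Finset.sum_ite_eq', Finset.mem_univ, if_true]
    ring
  have e1 := hα hz
  have e2 := ih _ hlt z rfl
  rw [hdist]
  linarith [measureReal_ne_triangle μ x z y]

/-- Every vertex of the simplex receives its own label. -/
theorem mixedScheme_ae_vertex (p : ℝ) (φ : ℝ → ℝ) {x : stdSimplex ℝ (Fin k)} {i : Fin k}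
    (hx : (x : Fin k → ℝ) = Pi.single i 1) : ∀ᵐ lab ∂mixedScheme k p φ, lab x = i := by
  classical
  have hxi : ∀ l, x l = if l = i then 1 else 0 := fun l => by
    rw [hx, Pi.single_apply]
  have hm : MeasurableSet {lab : Labeling k | lab x = i} :=
    measurableSet_eq_fun (measurable_pi_apply x) measurable_const
  have hpos : ∀ l, 0 < x l → l = i := fun l hl => by
    by_contra hne
    rw [hxi, if_neg hne] at hl
    exact hl.false
  refine ae_add_measure_iff.2 ⟨Measure.ae_smul_measure ?_ _, Measure.ae_smul_measure ?_ _⟩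
  · refine (ae_map_iff measurable_clockLabeling.aemeasurable hm).2 (.of_forall fun z => ?_)
    exact hpos _ (Fin.find_spec (exists_isClockMin z x)).1
  · rw [ae_iff, ← Set.compl_ofPred, singleThreshold_apply φ hm.compl]
    refine Finset.sum_eq_zero fun σ _ => mul_eq_zero_of_right _ ?_
    change (thresholdMeasure φ) {θ | ¬ thresholdLabeling θ σ x = i} = 0
    rw [← ae_iff]
    filter_upwards [thresholdMeasure_ae_mem φ] with θ hθ
    have hle := Fin.find_le_of_pos (exists_captures θ σ x) (j := σ.symm i)
      (Or.inl (by rw [Equiv.apply_symm_apply, hxi, if_pos rfl]; exact hθ.2))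
    rcases Fin.find_spec (exists_captures θ σ x) with h | h
    -- A positive threshold is met only by the coordinate `i`. In the remaining case the last step
    -- captures by default; as `θ ≤ 1` bounds the capturing step by `σ.symm i`, that last step is
    -- `σ.symm i` itself.
    · exact hpos _ (hθ.1.trans_le h)
    · have : σ.symm i ≤ Fin.find (Captures θ σ x) (exists_captures θ σ x) :=
        Fin.le_def.2 (by have := (σ.symm i).isLt; omega)
      have he := le_antisymm hle this
      unfold thresholdLabeling
      rw [← Equiv.eq_symm_apply]
      exact he

end Mixed

/-! ### Cuts and the relaxation -/

section Relaxation

variable {V : Type*} {k : ℕ}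

/-- Labels are constant along walks that avoid the cut edges, while terminals have distinct labels.
-/
theorem isMultiwayCut_cutEdges [Fintype V] (G : SimpleGraph V) (t : Fin k → V) {f : V → Fin k}
    (hf : ∀ i, f (t i) = i) : IsMultiwayCut G t (cutEdges G f) := by
  classical
  refine ⟨fun e he => ?_, fun i j hij hr => hij ?_⟩
  · have := (Finset.mem_filter.1 (Finset.mem_coe.1 he)).1
    simpa using this
  · have hstep : ∀ u v, (G.deleteEdges (cutEdges G f : Set (Sym2 V))).Reachable u v →
        f u = f v := by
      rintro u v ⟨q⟩
      induction q with
      | nil => rfl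
      | cons h _ ih =>
        rw [← ih]
        rw [SimpleGraph.deleteEdges_adj] at h
        by_contra hne
        refine h.2 (Finset.mem_coe.2 (Finset.mem_filter.2 ⟨?_, ?_⟩))
        · simpa using h.1
        · simpa using hne
    rw [← hf i, ← hf j]
    exact hstep _ _ hr

open Classical in
theorem weight_cutEdges [Fintype V] (G : SimpleGraph V) (w : Sym2 V → ℝ) (f : V → Fin k) :
    weight w (cutEdges G f) =
      ∑ e ∈ G.edgeFinset, if ¬ (e.map f).IsDiag then w e else 0 := by
  rw [weight, cutEdges, Finset.sum_filter]

theorem setOf_not_isDiag_map (x : V → stdSimplex ℝ (Fin k)) (u v : V) :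
    {lab : Labeling k | ¬ (s(u, v).map fun v => lab (x v)).IsDiag} =
      {lab | lab (x u) ≠ lab (x v)} := by
  ext; simp

theorem measurableSet_not_isDiag_map (x : V → stdSimplex ℝ (Fin k)) (e : Sym2 V) :
    MeasurableSet {lab : Labeling k | ¬ (e.map fun v => lab (x v)).IsDiag} := by
  induction e with
  | _ u v =>
    rw [setOf_not_isDiag_map]
    exact measurableSet_labeling_ne _ _

/-- Rounding with a scheme that separates points with probability at most `α` times their distance
loses at most a factor `α`. -/
theorem integrable_and_integral_weight_cutEdges_le [Fintype V] (G : SimpleGraph V)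
    (w : Sym2 V → ℝ) (hw : ∀ e ∈ G.edgeSet, 0 ≤ w e) (μ : Measure (Labeling k))
    [IsFiniteMeasure μ] {α : ℝ}
    (hα : ∀ x y : stdSimplex ℝ (Fin k),
      μ.real {lab | lab x ≠ lab y} ≤ α * ((1 / 2) * ∑ i, |x i - y i|))
    (x : V → stdSimplex ℝ (Fin k)) :
    Integrable (fun lab => weight w (cutEdges G fun v => lab (x v))) μ ∧
      ∫ lab, weight w (cutEdges G fun v => lab (x v)) ∂μ ≤ α * lpValue G w x := by
  classical
  have hm := measurableSet_not_isDiag_map (k := k) x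
  have hind : ∀ e, (fun lab : Labeling k =>
      if ¬ (e.map fun v => lab (x v)).IsDiag then w e else 0) =
      Set.indicator {lab : Labeling k | ¬ (e.map fun v => lab (x v)).IsDiag} fun _ => w e := by
    intro e
    ext lab
    simp only [Set.indicator_apply, Set.mem_ofPred_eq]
  have hint : ∀ e ∈ G.edgeFinset, Integrable (fun lab : Labeling k =>
      if ¬ (e.map fun v => lab (x v)).IsDiag then w e else 0) μ := fun e _ => by
    rw [hind]
    exact (integrable_const _).indicator (hm e)
  have heq : (fun lab : Labeling k => weight w (cutEdges G fun v => lab (x v))) = fun lab =>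
      ∑ e ∈ G.edgeFinset, if ¬ (e.map fun v => lab (x v)).IsDiag then w e else 0 := by
    ext lab
    rw [weight_cutEdges]
  rw [heq]
  refine ⟨integrable_finsetSum _ hint, ?_⟩
  rw [integral_finsetSum _ hint, lpValue, Finset.mul_sum]
  refine (Finset.sum_le_sum (g := fun e => α * (w e * edgeLength x e)) fun e he => ?_).trans_eq
    (by congr!)
  rw [hind, integral_indicator_const _ (hm e), smul_eq_mul]
  have hwe := hw e (by simpa using he)
  induction e with
  | _ u v =>
    rw [setOf_not_isDiag_map]
    have := mul_le_mul_of_nonneg_left (hα (x u) (x v)) hwe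
    simp only [edgeLength, Sym2.lift_mk]
    linarith

theorem continuous_lpValue [Fintype V] (G : SimpleGraph V) (w : Sym2 V → ℝ) :
    Continuous fun x : V → stdSimplex ℝ (Fin k) => lpValue G w x := by
  classical
  have hc : ∀ (v : V) (i : Fin k), Continuous fun x : V → stdSimplex ℝ (Fin k) => x v i :=
    fun v i => (continuous_apply i).comp (continuous_subtype_val.comp (continuous_apply v))
  unfold lpValue
  refine continuous_finsetSum _ fun e _ => continuous_const.mul ?_
  induction e with
  | _ u v =>
    simp only [edgeLength, Sym2.lift_mk]
    exact continuous_const.mul (continuous_finsetSum _ fun i _ => ((hc u i).sub (hc v i)).abs)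

/-- The integral solution of the relaxation given by a labeling of the vertices. -/
noncomputable def integralSolution (f : V → Fin k) (v : V) : stdSimplex ℝ (Fin k) :=
  ⟨Pi.single (f v) 1, single_mem_stdSimplex ℝ (f v)⟩

theorem integralSolution_apply (f : V → Fin k) (v : V) (i : Fin k) :
    integralSolution f v i = (Pi.single (f v) 1 : Fin k → ℝ) i := rfl

theorem isFeasible_integralSolution {t : Fin k → V} {f : V → Fin k} (hf : ∀ i, f (t i) = i) :
    IsFeasible t (integralSolution f) := fun i => by
  ext l
  rw [integralSolution_apply, hf]

/-- A continuous objective attains its minimum on a closed subset of a product of compact simplices.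
A left inverse of `t` supplies a feasible point. -/
theorem exists_isOptimal [Fintype V] (G : SimpleGraph V) (w : Sym2 V → ℝ) {t : Fin k → V}
    (hk : 0 < k) (ht : Function.Injective t) :
    ∃ x : V → stdSimplex ℝ (Fin k), IsOptimal G w t x := by
  have hclosed : IsClosed {x : V → stdSimplex ℝ (Fin k) | IsFeasible t x} := by
    simp only [IsFeasible, Set.ofPred_forall]
    refine isClosed_iInter fun i => isClosed_eq ?_ continuous_const
    exact continuous_subtype_val.comp (continuous_apply (t i))
  have : Nonempty (Fin k) := ⟨⟨0, hk⟩⟩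
  obtain ⟨x, hx, hmin⟩ := hclosed.isCompact.exists_isMinOn
    ⟨integralSolution (Function.invFun t), isFeasible_integralSolution
      (Function.leftInverse_invFun ht)⟩ (continuous_lpValue G w).continuousOn
  exact ⟨x, hx, fun y hy => hmin hy⟩

theorem edgeLength_integralSolution_le_one (f : V → Fin k) (e : Sym2 V) :
    edgeLength (integralSolution f) e ≤ 1 := by
  induction e with
  | _ u v =>
    simp only [edgeLength, Sym2.lift_mk]
    have h : ∑ i, |integralSolution f u i - integralSolution f v i| ≤
        ∑ i, (integralSolution f u i + integralSolution f v i) :=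
      Finset.sum_le_sum fun i _ => (abs_sub _ _).trans_eq (by
        rw [abs_of_nonneg (stdSimplex.zero_le _ i), abs_of_nonneg (stdSimplex.zero_le _ i)])
    rw [Finset.sum_add_distrib, stdSimplex.sum_eq_one, stdSimplex.sum_eq_one] at h
    linarith

/-- Every multiway cut weighs at least as much as some feasible solution of the relaxation. -/
theorem exists_isFeasible_lpValue_le [Fintype V] (G : SimpleGraph V) (w : Sym2 V → ℝ)
    (hw : ∀ e ∈ G.edgeSet, 0 ≤ w e) {t : Fin k → V} (hk : 0 < k) {F : Finset (Sym2 V)}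
    (hF : IsMultiwayCut G t F) :
    ∃ x : V → stdSimplex ℝ (Fin k), IsFeasible t x ∧ lpValue G w x ≤ weight w F := by
  classical
  set H := G.deleteEdges (F : Set (Sym2 V))
  -- Each vertex gets the terminal of its component after deleting `F`, unique because `F` is a cut.
  -- Components without a terminal all get label 0, so edges outside `F` have length zero.
  set f : V → Fin k := fun v =>
    if h : ∃ i, H.Reachable (t i) v then h.choose else ⟨0, hk⟩ with hfdef
  have hft : ∀ i v, H.Reachable (t i) v → f v = i := by
    intro i v h
    have hex : ∃ i, H.Reachable (t i) v := ⟨i, h⟩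
    simp only [hfdef, dif_pos hex]
    by_contra hne
    exact hF.2 _ _ hne (hex.choose_spec.trans h.symm)
  have hadj : ∀ u v, H.Adj u v → f u = f v := by
    intro u v h
    by_cases hex : ∃ i, H.Reachable (t i) u
    · obtain ⟨i, hi⟩ := hex
      rw [hft i u hi, hft i v (hi.trans h.reachable)]
    · have hex' : ¬ ∃ i, H.Reachable (t i) v := fun ⟨i, hi⟩ =>
        hex ⟨i, hi.trans h.symm.reachable⟩
      simp only [hfdef, dif_neg hex, dif_neg hex']
  refine ⟨integralSolution f, isFeasible_integralSolution fun i => hft i _ (.refl _), ?_⟩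
  have hsub : F ⊆ G.edgeFinset := fun e he => by simpa using hF.1 (Finset.mem_coe.2 he)
  have hzero : ∀ e ∈ G.edgeFinset, e ∉ F → w e * edgeLength (integralSolution f) e = 0 := by
    intro e he heF
    induction e with
    | _ u v =>
      have hu : f u = f v := hadj u v (by
        rw [SimpleGraph.deleteEdges_adj]
        exact ⟨by simpa using he, by simpa using heF⟩)
      simp [edgeLength, integralSolution_apply, hu]
  calc lpValue G w (integralSolution f)
      = ∑ e ∈ G.edgeFinset, w e * edgeLength (integralSolution f) e := by
        unfold lpValue; congr!
    _ = ∑ e ∈ F, w e * edgeLength (integralSolution f) e :=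
        (Finset.sum_subset hsub hzero).symm
    _ ≤ ∑ e ∈ F, w e := Finset.sum_le_sum fun e he =>
        mul_le_of_le_one_right (hw e (hF.1 (Finset.mem_coe.2 he)))
          (edgeLength_integralSolution_le_one f e)

end Relaxation

end MultiwayCut

theorem theorem1 {V : Type*} [Fintype V] (G : SimpleGraph V) (w : Sym2 V → ℝ)
    (hw : ∀ e ∈ G.edgeSet, 0 ≤ w e) (k : ℕ) (hk : 0 < k) (t : Fin k → V)
    (ht : Function.Injective t) (a b p α : ℝ)
    (ha : a = (4 + 2 * Real.sqrt 5) / 3) (hb : b = Real.sqrt 5 - 2)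
    (hp : p = (5 + 3 * Real.sqrt 5) / 20) (hα : α = (3 + Real.sqrt 5) / 4)
    (μ : MeasureTheory.Measure (MultiwayCut.Labeling k))
    (hμ : μ = MultiwayCut.mixedScheme k p (MultiwayCut.thresholdDensity a b)) :
    MeasureTheory.IsProbabilityMeasure μ ∧
    (∃ x : V → stdSimplex ℝ (Fin k), MultiwayCut.IsOptimal G w t x) ∧
    (∀ x : V → stdSimplex ℝ (Fin k), MultiwayCut.IsFeasible t x →
      (∀ᵐ lab ∂μ, (∀ i : Fin k, lab (x (t i)) = i) ∧
        MultiwayCut.IsMultiwayCut G t (MultiwayCut.cutEdges G fun v => lab (x v))) ∧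
      MeasureTheory.Integrable
        (fun lab => MultiwayCut.weight w (MultiwayCut.cutEdges G fun v => lab (x v))) μ ∧
      ∫ lab, MultiwayCut.weight w (MultiwayCut.cutEdges G fun v => lab (x v)) ∂μ ≤
        α * MultiwayCut.lpValue G w x) ∧
    (∀ x : V → stdSimplex ℝ (Fin k), MultiwayCut.IsOptimal G w t x →
      ∀ F : Finset (Sym2 V), MultiwayCut.IsMultiwayCut G t F →
        ∫ lab, MultiwayCut.weight w (MultiwayCut.cutEdges G fun v => lab (x v)) ∂μ ≤
          α * MultiwayCut.weight w F) := by
  have h5 : Real.sqrt 5 ^ 2 = 5 := Real.sq_sqrt (by norm_num)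
  have hl : 2 < Real.sqrt 5 := Real.lt_sqrt_of_sq_lt (by norm_num)
  have hu : Real.sqrt 5 < 3 := (Real.sqrt_lt' (by norm_num)).2 (by norm_num)
  have ha0 : 0 ≤ a := by rw [ha]; positivity
  have hb0 : 0 ≤ b := by rw [hb]; linarith
  have hb1 : b ≤ 1 := by rw [hb]; linarith
  have hp0 : 0 ≤ p := by rw [hp]; positivity
  have hp1 : p ≤ 1 := by rw [hp]; linarith
  have hα0 : 0 ≤ α := by rw [hα]; positivity
  -- The three identities that fix the constants: total mass one, cancellation of the
  -- `x`-dependence, and the resulting ratio. The first two determine `a` and `p` from `b`, giving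
  -- ratio `2 (2 + b) / (3 + 2 b - b²)`; its minimum over `0 ≤ b ≤ 1` is at the root `√5 - 2` of `b²
  -- + 4 b = 1`.
  have hmass : a * (1 + 2 * b - b ^ 2) = 4 := by
    rw [ha, hb]
    linear_combination (8 / 3 - 2 / 3 * Real.sqrt 5) * h5
  have hap : (1 - p) * a = 2 * p := by
    rw [ha, hp]
    linear_combination (-1 / 10) * h5
  have hαp : p * (2 + b) = α := by
    rw [hα, hb, hp]
    linear_combination (3 / 20) * h5
  have := MultiwayCut.isProbabilityMeasure_thresholdMeasure ha0 hb0 hb1 hmass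
  have hprob : MeasureTheory.IsProbabilityMeasure μ :=
    hμ ▸ MultiwayCut.isProbabilityMeasure_mixedScheme hp0 hp1 _
  have hsep : ∀ x y : stdSimplex ℝ (Fin k),
      μ.real {lab | lab x ≠ lab y} ≤ α * ((1 / 2) * ∑ i, |x i - y i|) :=
    MultiwayCut.measureReal_ne_le_dist μ
      (MultiwayCut.measureReal_ne_le_of_isTransfer μ fun h hx => by
        rw [hμ, ← hαp]
        exact MultiwayCut.mixedScheme_ne_le_of_le ha0 hb0 hp0 hp1 hap h hx)
  have hround := MultiwayCut.integrable_and_integral_weight_cutEdges_le G w hw μ hsep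
  refine ⟨hprob, MultiwayCut.exists_isOptimal G w hk ht, fun x hx => ⟨?_, hround x⟩,
    fun x hx F hF => ?_⟩
  · have hlab : ∀ᵐ lab ∂μ, ∀ i : Fin k, lab (x (t i)) = i :=
      MeasureTheory.ae_all_iff.2 fun i => hμ ▸ MultiwayCut.mixedScheme_ae_vertex p _ (hx i)
    filter_upwards [hlab] with lab h
    exact ⟨h, MultiwayCut.isMultiwayCut_cutEdges G t h⟩
  · obtain ⟨y, hy, hyF⟩ := MultiwayCut.exists_isFeasible_lpValue_le G w hw hk hF
    exact (hround x).2.trans (mul_le_mul_of_nonneg_left ((hx.2 y hy).trans hyF) hα0)
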